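/- Call a connected Hausdorff space in which every point has an open neighbourhood homeomorphic to an open subset of $\mathbb{R}^2$ a surface (no countability axiom is required). A ($1$-dimensional) foliation $\mathcal F$ on a surface $M$ is a maximal atlas of charts $\varphi_i\colon U_i\to\mathbb{R}\times\mathbb{R}$ (homeomorphisms from open sets $U_i\subset M$ onto open subsets of $\mathbb{R}\times\mathbb{R}$) whose coordinate transformations are, near every point of their domains, of the form $\varphi_j\varphi_i^{-1}(x,y)=(g(x,y),h(y))$ with $h$ a homeomorphism between open subsets of $\mathbb{R}$. The connected components of the sets $\varphi_i^{-1}(\mathbb{R}\times\{y\})$ are called plaques; they generate a topology on the set $M$, the leaf topology, and the path components of $M$ in this topology are the leaves of $\mathcal F$. The foliation is minimal if every leaf is dense in $M$ (for the original topology), and a leaf is a real line if, with the leaf topology, it is homeomorphic to $\mathbb{R}$. **Theorem.** There is a minimal foliation on a non-metrisable surface such that all leaves are real lines. -/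

import Mathlib

universe u

/-- A surface: a connected Hausdorff space each of whose points has an open neighbourhood
homeomorphic to an open subset of the Euclidean plane (no boundary, no countability axiom). -/
structure IsSurface (M : Type u) [TopologicalSpace M] : Prop where
  hausdorff : T2Space M
  connected : ConnectedSpace M
  locallyEuclidean : ∀ x : M,
    ∃ e : OpenPartialHomeomorph M (EuclideanSpace ℝ (Fin 2)), x ∈ e.source

/-- A coordinate transformation `T` between open subsets of `ℝ × ℝ` is foliated if, near each
point of its domain, it has the form `T (x, y) = (g (x, y), h y)`, where `h` is a homeomorphism
between open subsets of `ℝ`; there is no condition on `g` beyond those that `T` imposes. -/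
def IsFoliatedTransition (T : OpenPartialHomeomorph (ℝ × ℝ) (ℝ × ℝ)) : Prop :=
  ∀ z ∈ T.source, ∃ O : Set (ℝ × ℝ), IsOpen O ∧ z ∈ O ∧ O ⊆ T.source ∧
    ∃ h : OpenPartialHomeomorph ℝ ℝ, ∀ w ∈ O, w.2 ∈ h.source ∧ (T w).2 = h w.2

/-- A one-dimensional foliation of a two-dimensional manifold: a maximal atlas of charts in
`ℝ × ℝ` all of whose coordinate transformations are foliated. -/
structure Foliation (M : Type u) [TopologicalSpace M] where
  /-- The foliated charts. -/
  charts : Set (OpenPartialHomeomorph M (ℝ × ℝ))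
  cover : ∀ x : M, ∃ e ∈ charts, x ∈ e.source
  compatible : ∀ e ∈ charts, ∀ e' ∈ charts, IsFoliatedTransition (e.symm.trans e')
  maximal : ∀ e : OpenPartialHomeomorph M (ℝ × ℝ),
    (∀ e' ∈ charts, IsFoliatedTransition (e.symm.trans e') ∧
      IsFoliatedTransition (e'.symm.trans e)) → e ∈ charts

namespace Foliation

variable {M : Type u} [TopologicalSpace M]

/-- The plaques: the connected components (in the topology of `M`) of the sets
`e ⁻¹ (ℝ × {y})`, for `e` a foliated chart. -/
def plaques (F : Foliation M) : Set (Set M) :=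
  {P | ∃ e ∈ F.charts, ∃ x ∈ e.source,
    P = connectedComponentIn {z | z ∈ e.source ∧ (e z).2 = (e x).2} x}

/-- The leaf topology on the underlying set of `M`, generated by the plaques. -/
@[reducible] def leafTopology (F : Foliation M) : TopologicalSpace M :=
  TopologicalSpace.generateFrom F.plaques

/-- The leaf through `x`: the path component of `x` in the leaf topology. -/
def leaf (F : Foliation M) (x : M) : Set M :=
  @pathComponent M F.leafTopology x

/-- The topology of a leaf, induced by the leaf topology. -/
@[reducible] def topologyOnLeaf (F : Foliation M) (x : M) : TopologicalSpace (F.leaf x) :=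
  TopologicalSpace.induced Subtype.val F.leafTopology

/-- The leaf through `x`, with its leaf topology, is homeomorphic to the real line. -/
def LeafIsRealLine (F : Foliation M) (x : M) : Prop :=
  Nonempty (@Homeomorph (F.leaf x) ℝ (F.topologyOnLeaf x) inferInstance)

/-- A foliation is minimal if every leaf is dense in the topology of `M`. -/
def IsMinimal (F : Foliation M) : Prop :=
  ∀ x : M, Dense (F.leaf x)

end Foliation

open Set Filter Topology

/-! Start from the Kronecker foliation of the torus with slope `√2`, in coordinates `w` with `w.1`
time along a leaf and `w.2` transverse. A Cantor set of points `κ a` on the transversal `w.1 = 0` is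
chosen with no two on the same leaf. At each of them a ray is attached: the map `(y, u) ↦ (z, κ a +
u)`, with `z - u ^ 2 / z = y`, squeezes the plane minus the closed ray `u = 0`, `y ≤ 0` onto the
half plane `z > 0`, and the ray is inserted in place of its limit point. Transverse coordinates are
only translated, so the foliation extends.

The leaf through `κ a` breaks in two: the forward half line prolonged by the ray, and the open
backward half line. Other leaves keep their shape, so all are real lines. Each leaf contains a half
leaf of the Kronecker foliation, and such half leaves are dense by irrational rotation
(`exists_add_kroneckerMap_mem`); this gives minimality.

A dense leaf makes the surface separable, so a metric would make it Lindelöf. But the attached point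
of each of uncountably many rays lies in only one of the parametrised open sets.

Independence of the `κ a` modulo `ℤ + √2 ℤ` comes from Liouville numbers
(`exists_cantor_independent_sqrt_two`). Leaves are identified by covering the surface with injective
tangent curves whose ranges are equal or disjoint (`leaf_eq_range`). -/

/-! ### Maximal foliated atlases -/

theorem IsFoliatedTransition.of_common {M : Type*} [TopologicalSpace M]
    {a e e' : OpenPartialHomeomorph M (ℝ × ℝ)} {x : M} (ha : x ∈ a.source) (he : x ∈ e.source)
    (he' : x ∈ e'.source) (h : IsFoliatedTransition (a.symm.trans e))
    (h' : IsFoliatedTransition (a.symm.trans e')) :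
    ∃ O : Set (ℝ × ℝ), IsOpen O ∧ e x ∈ O ∧ O ⊆ (e.symm.trans e').source ∧
      ∃ k : OpenPartialHomeomorph ℝ ℝ,
        ∀ w ∈ O, w.2 ∈ k.source ∧ (e.symm.trans e' w).2 = k w.2 := by
  obtain ⟨O₁, hO₁, hx₁, hs₁, k₁, hk₁⟩ := h (a x) (by simp [ha, he])
  obtain ⟨O₂, hO₂, hx₂, hs₂, k₂, hk₂⟩ := h' (a x) (by simp [ha, he'])
  have hopen : IsOpen (a.source ∩ a ⁻¹' (O₁ ∩ O₂)) :=
    a.isOpen_inter_preimage (hO₁.inter hO₂)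
  -- Near `e x` the transition factors through `a`, so its transverse part is `k₁.symm` followed by
  -- `k₂`.
  refine ⟨(e.symm.trans e').source ∩ (e.symm.source ∩ e.symm ⁻¹' (a.source ∩ a ⁻¹' (O₁ ∩ O₂))),
    (e.symm.trans e').open_source.inter (e.symm.isOpen_inter_preimage hopen), ?_,
    inter_subset_left, k₁.symm.trans k₂, ?_⟩
  · simp [he, he', ha, hx₁, hx₂]
  · rintro w ⟨hw, hwe, hwa, hw₁, hw₂⟩
    have hv : a.symm (a (e.symm w)) = e.symm w := a.left_inv hwa
    have h1 := hk₁ _ hw₁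
    have h2 := hk₂ _ hw₂
    have hwt : w ∈ e.target := hwe
    simp only [OpenPartialHomeomorph.coe_trans, Function.comp_apply, hv, e.right_inv hwt] at h1 h2
    have h3 : k₁.symm w.2 = (a (e.symm w)).2 := by rw [h1.2, k₁.left_inv h1.1]
    refine ⟨?_, ?_⟩
    · simp only [OpenPartialHomeomorph.trans_source, OpenPartialHomeomorph.symm_source, mem_inter_iff,
        mem_preimage]
      exact ⟨h1.2 ▸ k₁.map_source h1.1, h3 ▸ h2.1⟩
    · simp only [OpenPartialHomeomorph.coe_trans, Function.comp_apply]
      rw [h3, ← h2.2]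

namespace Foliation

variable {M : Type*} [TopologicalSpace M]

/-- The foliation whose charts are all charts compatible with a given foliated atlas. -/
def ofAtlas (A : Set (OpenPartialHomeomorph M (ℝ × ℝ))) (hcover : ∀ x : M, ∃ e ∈ A, x ∈ e.source)
    (hA : ∀ e ∈ A, ∀ e' ∈ A, IsFoliatedTransition (e.symm.trans e')) : Foliation M where
  -- One direction is enough: the transverse homeomorphisms can be inverted, as in
  -- `IsFoliatedTransition.of_common`.
  charts := {e | ∀ a ∈ A, IsFoliatedTransition (a.symm.trans e)}
  cover x := by
    obtain ⟨e, he, hx⟩ := hcover x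
    exact ⟨e, fun a ha => hA a ha e he, hx⟩
  compatible e he e' he' z hz := by
    have hz' : z ∈ e.target ∧ e.symm z ∈ e'.source := by simpa using hz
    obtain ⟨a, ha, hx⟩ := hcover (e.symm z)
    have := IsFoliatedTransition.of_common hx (e.map_target hz'.1) hz'.2 (he a ha) (he' a ha)
    rwa [e.right_inv hz'.1] at this
  maximal e he a ha := (he a fun b hb => hA b hb a ha).2

theorem mem_ofAtlas {A : Set (OpenPartialHomeomorph M (ℝ × ℝ))}
    {hcover : ∀ x : M, ∃ e ∈ A, x ∈ e.source}
    {hA : ∀ e ∈ A, ∀ e' ∈ A, IsFoliatedTransition (e.symm.trans e')}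
    {e : OpenPartialHomeomorph M (ℝ × ℝ)} (he : e ∈ A) : e ∈ (ofAtlas A hcover hA).charts :=
  fun a ha => hA a ha e he

/-- Restricted charts supply arbitrarily short plaques. -/
theorem restrOpen_mem (F : Foliation M) {e : OpenPartialHomeomorph M (ℝ × ℝ)} (he : e ∈ F.charts)
    (W : Set M) (hW : IsOpen W) : e.restrOpen W hW ∈ F.charts := by
  refine F.maximal _ fun e' he' => ⟨?_, ?_⟩
  · intro z hz
    have hz' : (z ∈ e.target ∧ e.symm z ∈ W) ∧ e.symm z ∈ e'.source := by
      simpa using hz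
    obtain ⟨O, hO, hzO, hs, h, hh⟩ := F.compatible e he e' he' z (by simp [hz'])
    exact ⟨O ∩ ((e.restrOpen W hW).symm.trans e').source,
      hO.inter (OpenPartialHomeomorph.open_source _), ⟨hzO, hz⟩, inter_subset_right, h,
      fun w hw => hh w hw.1⟩
  · intro z hz
    have hz' : z ∈ e'.target ∧ e'.symm z ∈ e.source ∧ e'.symm z ∈ W := by
      simpa using hz
    obtain ⟨O, hO, hzO, hs, h, hh⟩ := F.compatible e' he' e he z (by simp [hz'])
    exact ⟨O ∩ (e'.symm.trans (e.restrOpen W hW)).source,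
      hO.inter (OpenPartialHomeomorph.open_source _), ⟨hzO, hz⟩, inter_subset_right, h,
      fun w hw => hh w hw.1⟩

/-! ### Tangent curves and the leaf topology -/

/-- A curve which near each of its points is a horizontal line of a foliated chart, up to
reparametrisation. -/
def IsTangentLine (F : Foliation M) (γ : ℝ → M) : Prop :=
  ∀ s, ∃ e ∈ F.charts, ∃ c : ℝ, ∃ θ : ℝ → ℝ, IsOpenEmbedding θ ∧
    ∀ᶠ s' in 𝓝 s, γ s' ∈ e.source ∧ e (γ s') = (θ s', c)

namespace IsTangentLine

variable {F : Foliation M} {γ : ℝ → M}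

theorem continuous (hγ : F.IsTangentLine γ) : Continuous γ := by
  rw [continuous_iff_continuousAt]
  intro s
  obtain ⟨e, he, c, θ, hθ, hs⟩ := hγ s
  have hs0 := hs.self_of_nhds
  have h1 : γ =ᶠ[𝓝 s] fun s' => e.symm (θ s', c) := by
    filter_upwards [hs] with s' h
    rw [← h.2, e.left_inv h.1]
  have h2 : ContinuousAt (fun s' => e.symm (θ s', c)) s := by
    refine ContinuousAt.comp (f := fun s' => (θ s', c)) (g := e.symm) ?_ ?_
    · rw [← hs0.2]
      exact e.continuousAt_symm (e.map_source hs0.1)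
    · exact (hθ.continuous.prodMk continuous_const).continuousAt
  exact h2.congr h1.symm

theorem eventually_snd_eq (hγ : F.IsTangentLine γ) {e' : OpenPartialHomeomorph M (ℝ × ℝ)}
    (he' : e' ∈ F.charts) {s : ℝ} (hs' : γ s ∈ e'.source) :
    ∀ᶠ r in 𝓝 s, (e' (γ r)).2 = (e' (γ s)).2 := by
  obtain ⟨e, he, c, θ, hθ, hs⟩ := hγ s
  have hs0 := hs.self_of_nhds
  obtain ⟨O, hO, hzO, -, h, hh⟩ := F.compatible e he e' he' (e (γ s)) (by simp [hs0.1, hs'])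
  have hcont : ContinuousAt (fun r => (θ r, c)) s :=
    (hθ.continuous.prodMk continuous_const).continuousAt
  have hev : ∀ᶠ r in 𝓝 s, (θ r, c) ∈ O :=
    hcont.eventually_mem (hO.mem_nhds (by rw [← hs0.2]; exact hzO))
  have key : ∀ r, γ r ∈ e.source ∧ e (γ r) = (θ r, c) → (θ r, c) ∈ O →
      (e' (γ r)).2 = h c := by
    intro r hr hrO
    have := (hh _ hrO).2
    have hsymm : e.symm (θ r, c) = γ r := by rw [← hr.2, e.left_inv hr.1]
    simpa [hsymm] using this
  filter_upwards [hs, hev] with r hr hrO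
  rw [key r hr hrO, key s hs0 hev.self_of_nhds]

/-- A short interval around a parameter of the plaque is mapped to a connected subset of the same
level set, hence into the same component. -/
theorem isOpen_preimage_plaque (hγ : F.IsTangentLine γ) {P : Set M} (hP : P ∈ F.plaques) :
    IsOpen (γ ⁻¹' P) := by
  obtain ⟨e, he, x, hx, rfl⟩ := hP
  rw [isOpen_iff_mem_nhds]
  intro s hs
  have hs1 := connectedComponentIn_subset _ _ hs
  rw [connectedComponentIn_eq hs]
  have hev : ∀ᶠ r in 𝓝 s, γ r ∈ e.source ∧ (e (γ r)).2 = (e (γ s)).2 :=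
    (hγ.continuous.continuousAt.eventually_mem (e.open_source.mem_nhds hs1.1)).and
      (hγ.eventually_snd_eq he hs1.1)
  obtain ⟨ε, hε, hball⟩ := Metric.eventually_nhds_iff_ball.1 hev
  filter_upwards [Metric.ball_mem_nhds s hε] with r hr
  refine (((convex_ball s ε).isPreconnected).image γ hγ.continuous.continuousOn
    |>.subset_connectedComponentIn (mem_image_of_mem _ (Metric.mem_ball_self hε)) ?_)
    (mem_image_of_mem _ hr)
  rintro _ ⟨r, hr, rfl⟩
  have := hball r hr
  exact ⟨this.1, this.2.trans hs1.2⟩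

/-- Cutting the chart down to first coordinates in `θ '' J'` leaves, at height `c`, only points of
`γ '' J`. -/
theorem exists_plaque (hγ : F.IsTangentLine γ) {J : Set ℝ} (hJ : IsOpen J) {s : ℝ} (hs : s ∈ J) :
    ∃ P ∈ F.plaques, γ s ∈ P ∧ P ⊆ γ '' J := by
  obtain ⟨e, he, c, θ, hθ, hev⟩ := hγ s
  obtain ⟨J', hJ', hJ'o, hsJ'⟩ := eventually_nhds_iff.1 (hev.and (hJ.mem_nhds hs))
  have hWo : IsOpen (e.source ∩ e ⁻¹' (Prod.fst ⁻¹' (θ '' J'))) :=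
    e.isOpen_inter_preimage ((hθ.isOpenMap _ hJ'o).preimage continuous_fst)
  have h0 := (hJ' s hsJ').1
  have hmem : γ s ∈ (e.restrOpen _ hWo).source := by
    simp [h0.1, h0.2, hsJ', hθ.injective.eq_iff]
  refine ⟨_, ⟨_, F.restrOpen_mem he _ hWo, γ s, hmem, rfl⟩, ?_, ?_⟩
  · exact mem_connectedComponentIn ⟨hmem, rfl⟩
  · refine (connectedComponentIn_subset _ _).trans ?_
    rintro z ⟨hz, hz2⟩
    have hz' : z ∈ e.source ∧ ∃ r ∈ J', θ r = (e z).1 := by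
      simp at hz
      exact ⟨hz.1, hz.2⟩
    obtain ⟨hze, r, hr, hrz⟩ := hz'
    have hr' := hJ' r hr
    refine ⟨r, hr'.2, e.injOn hr'.1.1 hze ?_⟩
    rw [hr'.1.2]
    refine Prod.ext hrz ?_
    have : (e z).2 = (e (γ s)).2 := by simpa using hz2
    rw [this, h0.2]

theorem isOpenEmbedding (hγ : F.IsTangentLine γ) (hinj : Function.Injective γ) :
    @IsOpenEmbedding ℝ M _ F.leafTopology γ := by
  refine @IsOpenEmbedding.of_continuous_injective_isOpenMap _ _ γ _ F.leafTopology ?_ hinj ?_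
  · exact continuous_generateFrom_iff.2 fun P hP => hγ.isOpen_preimage_plaque hP
  · intro J hJ
    choose! P hP hsP hPJ using fun s (hs : s ∈ J) => hγ.exists_plaque hJ hs
    have : γ '' J = ⋃ s ∈ J, P s := by
      apply Subset.antisymm
      · rintro _ ⟨s, hs, rfl⟩
        exact mem_iUnion₂.2 ⟨s, hs, hsP s hs⟩
      · exact iUnion₂_subset hPJ
    rw [this]
    exact @isOpen_biUnion M ℝ F.leafTopology J P fun s hs =>
      TopologicalSpace.isOpen_generateFrom_of_mem (hP s hs)

end IsTangentLine

/-- The ranges are open and any two are equal or disjoint, so each is clopen; each is also path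
connected. -/
theorem _root_.pathComponent_eq_range_of_isOpenEmbedding {X Λ : Type*} [TopologicalSpace X]
    {γ : Λ → ℝ → X} (hγ : ∀ l, IsOpenEmbedding (γ l)) (hcover : ∀ x, ∃ l, x ∈ range (γ l))
    (hpart : ∀ l l' s s', γ l s = γ l' s' → range (γ l) ⊆ range (γ l')) {l : Λ} {x : X}
    (hx : x ∈ range (γ l)) : pathComponent x = range (γ l) := by
  have hclopen : IsClopen (range (γ l)) := by
    refine ⟨?_, (hγ l).isOpen_range⟩
    rw [← isOpen_compl_iff, isOpen_iff_forall_mem_open]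
    intro y hy
    obtain ⟨l', s', rfl⟩ := hcover y
    refine ⟨_, ?_, (hγ l').isOpen_range, mem_range_self s'⟩
    rintro _ ⟨r, rfl⟩ ⟨r', hr'⟩
    exact hy (hpart l' l _ _ hr'.symm (mem_range_self s'))
  apply Subset.antisymm
  · exact (isPathConnected_pathComponent (x := x)).isConnected.isPreconnected.subset_isClopen hclopen
      ⟨x, mem_pathComponent_self x, hx⟩
  · exact (isPathConnected_range (hγ l).continuous).subset_pathComponent hx

theorem _root_.nonempty_homeomorph_of_isOpenEmbedding {X : Type*} [TopologicalSpace X]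
    {γ : ℝ → X} (hγ : IsOpenEmbedding γ) {S : Set X} (hS : S = range γ) :
    Nonempty (S ≃ₜ ℝ) :=
  ⟨(Homeomorph.setCongr hS).trans hγ.isEmbedding.toHomeomorph.symm⟩

variable {F : Foliation M} {Λ : Type*} {γ : Λ → ℝ → M}

theorem leaf_eq_range (hγ : ∀ l, F.IsTangentLine (γ l)) (hinj : ∀ l, Function.Injective (γ l))
    (hcover : ∀ x, ∃ l, x ∈ range (γ l))
    (hpart : ∀ l l' s s', γ l s = γ l' s' → range (γ l) ⊆ range (γ l')) {l : Λ} {x : M}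
    (hx : x ∈ range (γ l)) : F.leaf x = range (γ l) :=
  @pathComponent_eq_range_of_isOpenEmbedding M Λ F.leafTopology γ
    (fun l => (hγ l).isOpenEmbedding (hinj l)) hcover hpart l x hx

theorem leafIsRealLine (hγ : ∀ l, F.IsTangentLine (γ l)) (hinj : ∀ l, Function.Injective (γ l))
    (hcover : ∀ x, ∃ l, x ∈ range (γ l))
    (hpart : ∀ l l' s s', γ l s = γ l' s' → range (γ l) ⊆ range (γ l')) (x : M) :
    F.LeafIsRealLine x := by
  obtain ⟨l, hl⟩ := hcover x
  exact @nonempty_homeomorph_of_isOpenEmbedding M F.leafTopology (γ l)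
    ((hγ l).isOpenEmbedding (hinj l)) _ (leaf_eq_range hγ hinj hcover hpart hl)

end Foliation

/-! ### Foliated surfaces glued from plane domains -/

/-- A family of parametrisations of a set by open subsets of the plane, whose coordinate
transformations are continuous and locally translate the second coordinate. -/
structure FoliatedGluing (ι M : Type*) where
  /-- The parametrisations. -/
  f : ι → ℝ × ℝ → M
  /-- The domains of the parametrisations. -/
  dom : ι → Set (ℝ × ℝ)
  isOpen_dom : ∀ i, IsOpen (dom i)
  cover : ∀ x, ∃ i, ∃ w ∈ dom i, f i w = x
  locally_injOn : ∀ i, ∀ w ∈ dom i, ∃ O ⊆ dom i, IsOpen O ∧ w ∈ O ∧ InjOn (f i) O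
  transition : ∀ i j w v, w ∈ dom i → v ∈ dom j → f i w = f j v →
    ∃ τ : ℝ × ℝ → ℝ × ℝ, ContinuousAt τ w ∧ τ w = v ∧
      ∀ᶠ w' in 𝓝 w, f j (τ w') = f i w' ∧ (τ w').2 = w'.2 + (v.2 - w.2)

namespace FoliatedGluing

variable {ι M : Type*} (A : FoliatedGluing ι M)

/-- The final topology of the parametrisations. -/
@[reducible] def topology : TopologicalSpace M where
  IsOpen V := ∀ i, IsOpen (A.dom i ∩ A.f i ⁻¹' V)
  isOpen_univ i := by simpa using A.isOpen_dom i
  isOpen_inter s t hs ht i := by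
    have := (hs i).inter (ht i)
    rwa [← inter_inter_distrib_left, ← preimage_inter] at this
  isOpen_sUnion S hS i := by
    rw [preimage_sUnion, inter_iUnion₂]
    exact isOpen_biUnion fun t ht => hS t ht i

theorem continuousOn (i : ι) :
    @ContinuousOn _ _ _ A.topology (A.f i) (A.dom i) := by
  let _ := A.topology
  exact (continuousOn_open_iff (A.isOpen_dom i)).2 fun V hV => hV i

theorem continuous_of_comp {X : Type*} [TopologicalSpace X] {g : M → X}
    (hg : ∀ i, Continuous fun w => g (A.f i w)) : @Continuous _ _ A.topology _ g := by
  let _ := A.topology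
  refine continuous_def.2 fun V hV i => ?_
  exact (A.isOpen_dom i).inter (hV.preimage (hg i))

/-- Near a point that `f j` sends into the image, `τ` leads back into `O`. Continuity of `τ` at that
one point suffices, because the point is arbitrary. -/
theorem isOpen_image {i : ι} {O : Set (ℝ × ℝ)} (hO : IsOpen O) (hs : O ⊆ A.dom i) :
    IsOpen[A.topology] (A.f i '' O) := by
  intro j
  rw [isOpen_iff_mem_nhds]
  rintro w ⟨hw, v, hv, hvw⟩
  obtain ⟨τ, hτ, hτw, hev⟩ := A.transition j i w v hw (hs hv) hvw.symm
  filter_upwards [(A.isOpen_dom j).mem_nhds hw, hev,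
    hτ.eventually_mem (hO.mem_nhds (hτw ▸ hv))] with w' h1 h2 h3
  exact ⟨h1, τ w', h3, h2.1⟩

/-- The local homeomorphism given by a parametrisation which is injective on an open set. -/
noncomputable def toHomeomorph (i : ι) (O : Set (ℝ × ℝ)) (hO : IsOpen O) (hs : O ⊆ A.dom i)
    (hinj : InjOn (A.f i) O) : @OpenPartialHomeomorph (ℝ × ℝ) M _ A.topology :=
  letI := A.topology
  OpenPartialHomeomorph.ofContinuousOpenRestrict (hinj.toPartialEquiv (A.f i) O)
    ((A.continuousOn i).mono hs)
    (by
      intro V hV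
      have : O.domRestrict (A.f i) '' V = A.f i '' (Subtype.val '' V) := by
        rw [image_image]; rfl
      change IsOpen (O.domRestrict (A.f i) '' V)
      rw [this]
      refine A.isOpen_image (hO.isOpenMap_subtype_val V hV) ?_
      rintro _ ⟨v, -, rfl⟩
      exact hs v.2)
    hO

/-- The charts inverse to the parametrisations. -/
def atlas : Set (@OpenPartialHomeomorph M (ℝ × ℝ) A.topology _) :=
  letI := A.topology
  {e | ∃ i O hO hs hinj, e = (A.toHomeomorph i O hO hs hinj).symm}

theorem exists_mem_atlas (i : ι) (w : ℝ × ℝ) (hw : w ∈ A.dom i) :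
    letI := A.topology
    ∃ e ∈ A.atlas, ∃ O ∈ 𝓝 w, ∀ v ∈ O, A.f i v ∈ e.source ∧ e (A.f i v) = v := by
  let _ := A.topology
  obtain ⟨O, hs, hO, hwO, hinj⟩ := A.locally_injOn i w hw
  refine ⟨_, ⟨i, O, hO, hs, hinj, rfl⟩, O, hO.mem_nhds hwO, fun v hv => ?_⟩
  exact ⟨(A.toHomeomorph i O hO hs hinj).map_source hv,
    (A.toHomeomorph i O hO hs hinj).left_inv hv⟩

theorem isFoliatedTransition_atlas :
    letI := A.topology
    ∀ e ∈ A.atlas, ∀ e' ∈ A.atlas, IsFoliatedTransition (e.symm.trans e') := by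
  let _ := A.topology
  rintro _ ⟨i, O, hO, hs, hinj, rfl⟩ _ ⟨j, O', hO', hs', hinj', rfl⟩ w hw
  have hw' : w ∈ O ∧ ∃ v ∈ O', A.f j v = A.f i w := by
    rw [OpenPartialHomeomorph.trans_source] at hw
    exact hw
  obtain ⟨hwO, v, hv, hvw⟩ := hw'
  obtain ⟨τ, hτ, hτw, hev⟩ := A.transition i j w v (hs hwO) (hs' hv) hvw.symm
  obtain ⟨N, hN, hNo, hwN⟩ := eventually_nhds_iff.1
    ((hev.and (hτ.eventually_mem (hO'.mem_nhds (hτw ▸ hv)))).and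
      ((OpenPartialHomeomorph.open_source _).mem_nhds hw))
  refine ⟨N, hNo, hwN, fun w' hw' => (hN w' hw').2,
    (Homeomorph.addRight (v.2 - w.2)).toOpenPartialHomeomorph, fun w' hw' => ⟨mem_univ _, ?_⟩⟩
  obtain ⟨⟨⟨h1, h2⟩, h3⟩, -⟩ := hN w' hw'
  have h4 : (A.toHomeomorph j O' hO' hs' hinj').symm (A.f i w') = τ w' := by
    rw [← h1]
    exact (A.toHomeomorph j O' hO' hs' hinj').left_inv h3
  change ((A.toHomeomorph j O' hO' hs' hinj').symm (A.f i w')).2 = w'.2 + (v.2 - w.2)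
  rw [h4, h2]

theorem exists_mem_atlas_source (x : M) :
    letI := A.topology
    ∃ e ∈ A.atlas, x ∈ e.source := by
  obtain ⟨i, w, hw, rfl⟩ := A.cover x
  obtain ⟨e, he, O, hO, h⟩ := A.exists_mem_atlas i w hw
  exact ⟨e, he, (h w (mem_of_mem_nhds hO)).1⟩

/-- The foliation whose leaves are locally the images of horizontal lines under the
parametrisations. -/
def foliation : @Foliation M A.topology :=
  letI := A.topology
  Foliation.ofAtlas A.atlas A.exists_mem_atlas_source A.isFoliatedTransition_atlas

theorem isTangentLine {γ : ℝ → M}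
    (hγ : ∀ s, ∃ i, ∃ c : ℝ, ∃ θ : ℝ → ℝ, IsOpenEmbedding θ ∧
      ∀ᶠ s' in 𝓝 s, (θ s', c) ∈ A.dom i ∧ γ s' = A.f i (θ s', c)) :
    @Foliation.IsTangentLine M A.topology A.foliation γ := by
  letI := A.topology
  intro s
  obtain ⟨i, c, θ, hθ, hs⟩ := hγ s
  obtain ⟨e, he, O, hO, h⟩ := A.exists_mem_atlas i _ hs.self_of_nhds.1
  have hc : ContinuousAt (fun s' => (θ s', c)) s :=
    (hθ.continuous.prodMk continuous_const).continuousAt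
  refine ⟨e, Foliation.mem_ofAtlas he, c, θ, hθ, ?_⟩
  filter_upwards [hs, hc hO] with s' h1 h2
  rw [h1.2]
  exact h _ h2

theorem exists_euclidean_chart (x : M) :
    letI := A.topology
    ∃ e : OpenPartialHomeomorph M (EuclideanSpace ℝ (Fin 2)), x ∈ e.source := by
  let _ := A.topology
  obtain ⟨e, -, hx⟩ := A.exists_mem_atlas_source x
  let h : ℝ × ℝ ≃ₜ EuclideanSpace ℝ (Fin 2) :=
    (Homeomorph.finTwoArrow (X := ℝ)).symm.trans
      (EuclideanSpace.equiv (Fin 2) ℝ).symm.toHomeomorph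
  exact ⟨e.trans h.toOpenPartialHomeomorph, by simpa using hx⟩

end FoliatedGluing

/-! ### A Cantor set independent modulo `ℤ + √2 ℤ` -/

open LiouvilleNumber in
theorem abs_tsum_div_two_pow_factorial_sub_lt {d : ℕ → ℤ} (hd : ∀ n, |d n| ≤ 1) (k : ℕ) :
    |∑' n, (d n : ℝ) / 2 ^ (n + 1).factorial -
      ∑ n ∈ Finset.range k, (d n : ℝ) / 2 ^ (n + 1).factorial| <
        1 / (2 ^ k.factorial) ^ k := by
  have hd' : ∀ n, |(d n : ℝ)| ≤ 1 := fun n => by exact_mod_cast hd n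
  have hle : ∀ n, ‖(d n : ℝ) / 2 ^ (n + 1).factorial‖ ≤ 1 / 2 ^ (n + 1).factorial := by
    intro n
    rw [norm_div, Real.norm_eq_abs, norm_pow, Real.norm_ofNat]
    gcongr
    exact hd' n
  have hsum : Summable fun n => (d n : ℝ) / 2 ^ (n + 1).factorial :=
    Summable.of_norm_bounded (remainder_summable one_lt_two 0) hle
  rw [← hsum.sum_add_tsum_nat_add k, add_sub_cancel_left]
  refine lt_of_le_of_lt ?_ (remainder_lt k le_rfl)
  rw [← Real.norm_eq_abs]
  refine tsum_of_norm_bounded (remainder_summable one_lt_two k).hasSum fun n => ?_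
  simpa [add_assoc] using hle (n + k)

theorem exists_sum_div_two_pow_factorial_eq (d : ℕ → ℤ) (k : ℕ) :
    ∃ A : ℤ, ∑ n ∈ Finset.range k, (d n : ℝ) / 2 ^ (n + 1).factorial = A / 2 ^ k.factorial := by
  induction k with
  | zero => exact ⟨0, by simp⟩
  | succ k ih =>
    obtain ⟨A, hA⟩ := ih
    refine ⟨A * 2 ^ ((k + 1).factorial - k.factorial) + d k, ?_⟩
    rw [Finset.sum_range_succ, hA]
    have : (2 : ℝ) ^ (k + 1).factorial =
        2 ^ ((k + 1).factorial - k.factorial) * 2 ^ k.factorial := by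
      rw [← pow_add, Nat.sub_add_cancel (Nat.factorial_le k.le_succ)]
    push_cast
    rw [this]
    field_simp

/-- The partial sums have denominator `2 ^ N.factorial` and error below its `N`-th inverse power;
irrationality keeps the error nonzero. -/
theorem liouville_tsum_div_two_pow_factorial {d : ℕ → ℤ} (hd : ∀ n, |d n| ≤ 1)
    (hirr : Irrational (∑' n, (d n : ℝ) / 2 ^ (n + 1).factorial)) :
    Liouville (∑' n, (d n : ℝ) / 2 ^ (n + 1).factorial) := by
  intro N
  obtain ⟨A, hA⟩ := exists_sum_div_two_pow_factorial_eq d N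
  refine ⟨A, 2 ^ N.factorial, one_lt_pow₀ one_lt_two N.factorial_ne_zero, ?_, ?_⟩
  · have := hirr.ne_rat ((A : ℚ) / 2 ^ N.factorial)
    push_cast at this ⊢
    exact this
  · have := abs_tsum_div_two_pow_factorial_sub_lt hd N
    rw [hA] at this
    push_cast
    exact this

/-- The first nonzero digit would outweigh the whole tail after it. -/
theorem tsum_div_two_pow_factorial_eq_zero {d : ℕ → ℤ} (hd : ∀ n, |d n| ≤ 1)
    (h0 : ∑' n, (d n : ℝ) / 2 ^ (n + 1).factorial = 0) : d = 0 := by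
  by_contra hne
  have hex : ∃ n, d n ≠ 0 := by
    by_contra! h
    exact hne (funext h)
  classical
  have h := abs_tsum_div_two_pow_factorial_sub_lt hd (Nat.find hex + 1)
  have hz : ∑ n ∈ Finset.range (Nat.find hex), (d n : ℝ) / 2 ^ (n + 1).factorial = 0 := by
    refine Finset.sum_eq_zero fun n hn => ?_
    have := Nat.find_min hex (Finset.mem_range.1 hn)
    simp [not_not.1 this]
  rw [Finset.sum_range_succ, hz, h0, zero_add, zero_sub, abs_neg, abs_div] at h
  have h1 : (1 : ℝ) ≤ |(d (Nat.find hex) : ℝ)| := by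
    exact_mod_cast Int.one_le_abs (Nat.find_spec hex)
  set b : ℝ := 2 ^ (Nat.find hex + 1).factorial with hb
  have hb1 : 1 ≤ b := one_le_pow₀ one_le_two
  have hb0 : 0 < b := by positivity
  have h2 : 1 / b ^ (Nat.find hex + 1) ≤ 1 / b :=
    one_div_le_one_div_of_le hb0 (le_self_pow₀ hb1 (Nat.succ_ne_zero _))
  have h3 : 1 / b ≤ |(d (Nat.find hex) : ℝ)| / |b| := by
    rw [abs_of_pos hb0]
    gcongr
  linarith

/-- A difference of two values is a series with digits in `{-1, 0, 1}`. For `n ≠ 0` it would be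
irrational and algebraic, yet Liouville and hence transcendental. For `n = 0` it is an integer of
absolute value below `1`, so it vanishes and all digits agree. -/
theorem exists_cantor_independent_sqrt_two :
    ∃ κ : (ℕ → Bool) → ℝ, Continuous κ ∧
      ∀ a b (m n : ℤ), κ a - κ b = m + n * √2 → a = b := by
  let t : Bool → ℤ := fun x => if x then 1 else 0
  have hle : ∀ (n : ℕ) (a : ℕ → Bool),
      ‖(t (a n) : ℝ) / 2 ^ (n + 1).factorial‖ ≤ 1 / 2 ^ (n + 1).factorial := by
    intro n a
    rw [norm_div, Real.norm_eq_abs, norm_pow, Real.norm_ofNat]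
    gcongr
    cases a n <;> simp [t]
  have hsum := LiouvilleNumber.remainder_summable one_lt_two 0
  refine ⟨fun a => ∑' n, (t (a n) : ℝ) / 2 ^ (n + 1).factorial, ?_, ?_⟩
  · refine continuous_tsum (fun n => ?_) hsum hle
    have : Continuous fun x : Bool => (t x : ℝ) / 2 ^ (n + 1).factorial := continuous_of_discreteTopology
    exact this.comp (continuous_apply n)
  · intro a b m n h
    rw [← Summable.tsum_sub (Summable.of_norm_bounded hsum (hle · a))
      (Summable.of_norm_bounded hsum (hle · b))] at h
    set d : ℕ → ℤ := fun n => t (a n) - t (b n) with hd_def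
    have hd : ∀ n, |d n| ≤ 1 := by
      intro n
      simp only [hd_def]
      cases a n <;> cases b n <;> simp [t]
    have hD : ∑' n, ((t (a n) : ℝ) / 2 ^ (n + 1).factorial - (t (b n) : ℝ) / 2 ^ (n + 1).factorial)
        = ∑' n, (d n : ℝ) / 2 ^ (n + 1).factorial := by
      refine tsum_congr fun n => ?_
      simp only [hd_def]
      push_cast
      ring
    rw [hD] at h
    have hn : n = 0 := by
      by_contra hn
      have hirr : Irrational (m + n * √2) := (irrational_sqrt_two.intCast_mul hn).intCast_add m
      have halg : IsAlgebraic ℤ ((m : ℝ) + n * √2) := by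
        have h2 : IsIntegral ℤ (√2) := by
          refine IsIntegral.of_pow (n := 2) two_pos ?_
          rw [Real.sq_sqrt zero_le_two]
          exact isIntegral_algebraMap (R := ℤ) (x := 2)
        have hm : IsIntegral ℤ (m : ℝ) := isIntegral_algebraMap (R := ℤ) (x := m)
        have hn : IsIntegral ℤ (n : ℝ) := isIntegral_algebraMap (R := ℤ) (x := n)
        exact (hm.add (hn.mul h2)).isAlgebraic
      rw [← h] at hirr halg
      exact (liouville_tsum_div_two_pow_factorial hd hirr).transcendental halg
    have hm : m = 0 := by
      -- With the empty partial sum the estimate says that the series has absolute value below `1`.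
      have := abs_tsum_div_two_pow_factorial_sub_lt hd 0
      rw [h, hn] at this
      simp only [Int.cast_zero, zero_mul, add_zero, Finset.range_zero, Finset.sum_empty, sub_zero,
        pow_zero, div_one] at this
      exact Int.abs_lt_one_iff.1 (by exact_mod_cast this)
    rw [hn, hm] at h
    have hd0 := tsum_div_two_pow_factorial_eq_zero hd (by simpa using h)
    funext i
    have := congrFun hd0 i
    simp only [hd_def, Pi.zero_apply] at this
    revert this
    cases a i <;> cases b i <;> simp [t]

/-! ### The Kronecker foliation of the torus -/

/-- The covering of the torus by the plane which maps horizontal lines to the lines of slope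
`√2`. -/
noncomputable def kroneckerMap (w : ℝ × ℝ) : UnitAddCircle × UnitAddCircle :=
  (((w.2 + √2 * w.1 : ℝ) : UnitAddCircle), ((w.1 : ℝ) : UnitAddCircle))

theorem kroneckerMap_add (v w : ℝ × ℝ) :
    kroneckerMap (v + w) = kroneckerMap v + kroneckerMap w := by
  simp only [kroneckerMap, Prod.mk_add_mk, ← AddCircle.coe_add, Prod.fst_add, Prod.snd_add]
  congr 2
  ring

theorem kroneckerMap_sub (v w : ℝ × ℝ) :
    kroneckerMap (v - w) = kroneckerMap v - kroneckerMap w := by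
  rw [eq_sub_iff_add_eq, ← kroneckerMap_add, sub_add_cancel]

theorem kroneckerMap_add_sub {v w : ℝ × ℝ} (h : kroneckerMap w = kroneckerMap v) (u : ℝ × ℝ) :
    kroneckerMap (u + (v - w)) = kroneckerMap u := by
  rw [kroneckerMap_add, kroneckerMap_sub, h, sub_self, add_zero]

theorem exists_int_of_kroneckerMap_eq {v w : ℝ × ℝ} (h : kroneckerMap w = kroneckerMap v) :
    ∃ m n : ℤ, w.1 - v.1 = n ∧ w.2 - v.2 = m + n * -√2 := by
  simp only [kroneckerMap, Prod.mk.injEq] at h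
  obtain ⟨h1, h2⟩ := h
  rw [← sub_eq_zero, ← AddCircle.coe_sub, AddCircle.coe_eq_zero_iff] at h1 h2
  obtain ⟨m, hm⟩ := h1
  obtain ⟨n, hn⟩ := h2
  simp only [zsmul_eq_mul, mul_one] at hm hn
  refine ⟨m, n, hn.symm, ?_⟩
  rw [hn, hm]
  ring

theorem eq_of_kroneckerMap_eq {v w : ℝ × ℝ} (h : kroneckerMap w = kroneckerMap v)
    (h1 : |w.1 - v.1| < 1) (h2 : |w.2 - v.2| < 1) : w = v := by
  obtain ⟨m, n, hn, hm⟩ := exists_int_of_kroneckerMap_eq h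
  rw [hn] at h1
  have hn0 : n = 0 := Int.abs_lt_one_iff.1 (by exact_mod_cast h1)
  rw [hm, hn0, Int.cast_zero, zero_mul, add_zero] at h2
  have hm0 : m = 0 := Int.abs_lt_one_iff.1 (by exact_mod_cast h2)
  simp only [hn0, hm0, Int.cast_zero, zero_mul, add_zero] at hn hm
  exact Prod.ext (sub_eq_zero.1 hn) (sub_eq_zero.1 hm)

/-- By irrationality of `√2`, no nonzero period of the covering is horizontal; so leaves do not
close up. -/
theorem eq_of_kroneckerMap_eq_of_snd_eq {v w : ℝ × ℝ} (h : kroneckerMap w = kroneckerMap v)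
    (h2 : w.2 = v.2) : w = v := by
  obtain ⟨m, n, hn, hm⟩ := exists_int_of_kroneckerMap_eq h
  rw [h2, sub_self] at hm
  have hn0 : n = 0 := by
    by_contra hn0
    refine (irrational_sqrt_two.intCast_mul hn0).ne_int m ?_
    linarith
  rw [hn0, Int.cast_zero] at hn
  exact Prod.ext (sub_eq_zero.1 hn) h2

theorem continuous_kroneckerMap : Continuous kroneckerMap := by
  unfold kroneckerMap
  exact (AddCircle.continuous_mk' 1 |>.comp (by fun_prop)).prodMk
    (AddCircle.continuous_mk' 1 |>.comp (by fun_prop))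

theorem kroneckerMap_surjective : Function.Surjective kroneckerMap := by
  rintro ⟨x, y⟩
  obtain ⟨x, rfl⟩ := QuotientAddGroup.mk_surjective x
  obtain ⟨y, rfl⟩ := QuotientAddGroup.mk_surjective y
  exact ⟨(y, x - √2 * y), by simp [kroneckerMap]⟩

theorem isOpenMap_kroneckerMap : IsOpenMap kroneckerMap := by
  let e : ℝ × ℝ ≃ₜ ℝ × ℝ :=
    { toFun w := (w.2 + √2 * w.1, w.1)
      invFun v := (v.2, v.1 - √2 * v.2)
      left_inv w := by simp
      right_inv v := by simp
      continuous_toFun := by fun_prop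
      continuous_invFun := by fun_prop }
  have h : IsOpenMap ((↑) : ℝ → UnitAddCircle) := QuotientAddGroup.isOpenMap_coe
  exact (h.prodMap h).comp e.isOpenMap

theorem exists_nat_add_nsmul_mem {β : ℝ} (hβ : Irrational β) {V : Set UnitAddCircle}
    (hV : IsOpen V) (hne : V.Nonempty) (c : UnitAddCircle) (N : ℕ) :
    ∃ n ≥ N, c + ((n * β : ℝ) : UnitAddCircle) ∈ V := by
  have hd : DenseRange (· • (β : UnitAddCircle) : ℕ → UnitAddCircle) :=
    denseRange_zsmul_iff_nsmul.1 (AddCircle.denseRange_zsmul_coe_iff.2 (by simpa using hβ))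
  obtain ⟨y, hy⟩ := hne
  obtain ⟨k, hk⟩ := hd.exists_mem_open
    (hV.preimage (continuous_const_add (c + ((N * β : ℝ) : UnitAddCircle))))
    ⟨y - (c + ((N * β : ℝ) : UnitAddCircle)), by simpa using hy⟩
  refine ⟨N + k, Nat.le_add_right _ _, ?_⟩
  rw [mem_preimage, add_assoc] at hk
  convert hk using 2
  push_cast
  rw [add_mul, AddCircle.coe_add, ← nsmul_eq_mul k β, AddCircle.coe_nsmul]

/-- Both ends of every leaf of the Kronecker foliation are dense. -/
theorem exists_add_kroneckerMap_mem {ε : ℤ} (hε : ε ≠ 0) {W : Set (UnitAddCircle × UnitAddCircle)}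
    (hW : IsOpen W) (hne : W.Nonempty) (q : UnitAddCircle × UnitAddCircle) :
    ∃ s > 0, q + kroneckerMap (ε * s, 0) ∈ W := by
  obtain ⟨⟨x, y⟩, hxy⟩ := hne
  obtain ⟨r, hr⟩ := QuotientAddGroup.mk_surjective (y - q.2)
  have hr' : (r : UnitAddCircle) = y - q.2 := hr
  have hε' : (ε : ℝ) ≠ 0 := by exact_mod_cast hε
  -- The time will be `r / ε + n` with `n ≥ N`, positive by this choice. Each such time returns to
  -- the circle at height `y`, where the first coordinates form an orbit of the rotation by `ε *
  -- √2`.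
  obtain ⟨N, hN⟩ := exists_nat_gt (-(r / ε))
  obtain ⟨n, hn, hnV⟩ := exists_nat_add_nsmul_mem (irrational_sqrt_two.intCast_mul hε)
    (hW.preimage (Continuous.prodMk_left y)) ⟨x, hxy⟩ (q.1 + ((√2 * r : ℝ) : UnitAddCircle)) N
  have hn' : (N : ℝ) ≤ n := by exact_mod_cast hn
  refine ⟨r / ε + n, by linarith, ?_⟩
  have he : (ε : ℝ) * (r / ε + n) = r + (ε * n : ℤ) := by
    push_cast; field_simp
  suffices h : q + kroneckerMap (ε * (r / ε + n), 0) =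
      (q.1 + ((√2 * r : ℝ) : UnitAddCircle) + ((n * (ε * √2) : ℝ) : UnitAddCircle), y) by
    rw [h]
    exact hnV
  refine Prod.ext ?_ ?_
  · simp only [kroneckerMap, Prod.fst_add, he]
    rw [add_assoc, ← AddCircle.coe_add]
    congr 2
    push_cast
    ring
  · simp only [kroneckerMap, Prod.snd_add, he]
    rw [AddCircle.coe_add, hr']
    have : (((ε * n : ℤ) : ℝ) : UnitAddCircle) = 0 :=
      (AddCircle.coe_eq_zero_iff 1).2 ⟨ε * n, by simp⟩
    rw [this, add_zero, add_sub_cancel]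

/-! ### Squeezing the plane onto a half plane -/

/-- The positive root `z` of `z - u ^ 2 / z = y`, extended continuously by `0` to `u = 0`,
`y ≤ 0`. -/
noncomputable def squeeze (w : ℝ × ℝ) : ℝ := (w.1 + √(w.1 ^ 2 + 4 * w.2 ^ 2)) / 2

theorem continuous_squeeze : Continuous squeeze := by
  unfold squeeze
  fun_prop

theorem squeeze_nonneg (w : ℝ × ℝ) : 0 ≤ squeeze w := by
  have : |w.1| ≤ √(w.1 ^ 2 + 4 * w.2 ^ 2) := Real.abs_le_sqrt (by nlinarith [sq_nonneg w.2])
  have := neg_abs_le w.1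
  unfold squeeze
  linarith

theorem squeeze_mul (w : ℝ × ℝ) : squeeze w * (squeeze w - w.1) = w.2 ^ 2 := by
  have := Real.sq_sqrt (show 0 ≤ w.1 ^ 2 + 4 * w.2 ^ 2 by positivity)
  unfold squeeze
  nlinarith

theorem squeeze_of_mul {z : ℝ} (hz : 0 < z) {w : ℝ × ℝ} (h : z * (z - w.1) = w.2 ^ 2) :
    squeeze w = z := by
  have h1 := squeeze_mul w
  have h0 := squeeze_nonneg w
  have h2 : w.1 ≤ z := by
    by_contra! hlt
    nlinarith [sq_nonneg w.2]
  have h3 : (squeeze w - z) * (squeeze w + z - w.1) = 0 := by linarith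
  rcases mul_eq_zero.1 h3 with h3 | h3
  · linarith
  -- The other root is nonpositive, so it can equal `squeeze w` only when both are `0`, which forces
  -- `w.2 = 0` and `z = w.1`.
  · have hs : squeeze w = 0 := by linarith
    have hw : w.2 ^ 2 = 0 := by rw [← h1, hs, zero_mul]
    rw [hw] at h
    have hz1 : z = w.1 := by
      rcases mul_eq_zero.1 h with h | h <;> linarith
    have : squeeze w = z := by
      unfold squeeze
      rw [hw, mul_zero, add_zero, Real.sqrt_sq (by linarith), hz1]
      ring
    exact this

theorem squeeze_eq_zero {w : ℝ × ℝ} (h : squeeze w = 0) : w.2 = 0 ∧ w.1 ≤ 0 := by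
  have h1 := squeeze_mul w
  rw [h, zero_mul] at h1
  refine ⟨pow_eq_zero_iff two_ne_zero |>.1 h1.symm, ?_⟩
  have := Real.sqrt_nonneg (w.1 ^ 2 + 4 * w.2 ^ 2)
  unfold squeeze at h
  linarith

theorem squeeze_zero_right (y : ℝ) : squeeze (y, 0) = max y 0 := by
  have : squeeze (y, 0) = (y + |y|) / 2 := by simp [squeeze, Real.sqrt_sq_eq_abs]
  rw [this]
  rcases le_total y 0 with h | h
  · rw [abs_of_nonpos h, max_eq_right h]; ring
  · rw [abs_of_nonneg h, max_eq_left h]; ring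

/-! ### The torus with rays attached -/

section BlackHole

variable {K : Type} (κ : K → ℝ)

/-- The torus together with an open ray for every element of `K`. -/
abbrev BlackHole (K : Type) : Type :=
  (UnitAddCircle × UnitAddCircle) ⊕ (K × Iio (0 : ℝ))

/-- The squeezing map of the plane onto the half plane above the point with coordinate `κ a`. -/
noncomputable def squeezeAt (a : K) (w : ℝ × ℝ) : ℝ × ℝ := (squeeze w, κ a + w.2)

/-- The inverse of `squeezeAt` on the open half plane. -/
noncomputable def unsqueezeAt (a : K) (v : ℝ × ℝ) : ℝ × ℝ :=
  (v.1 - (v.2 - κ a) ^ 2 / v.1, v.2 - κ a)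

theorem continuous_squeezeAt (a : K) : Continuous (squeezeAt κ a) := by
  unfold squeezeAt
  have := continuous_squeeze
  fun_prop

theorem continuousAt_unsqueezeAt (a : K) {v : ℝ × ℝ} (hv : 0 < v.1) :
    ContinuousAt (unsqueezeAt κ a) v := by
  unfold unsqueezeAt
  have := hv.ne'
  fun_prop (disch := assumption)

theorem squeezeAt_unsqueezeAt (a : K) {v : ℝ × ℝ} (hv : 0 < v.1) :
    squeezeAt κ a (unsqueezeAt κ a v) = v := by
  refine Prod.ext ?_ ?_
  · refine squeeze_of_mul hv ?_
    simp only [unsqueezeAt]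
    field_simp
    ring
  · simp [squeezeAt, unsqueezeAt]

theorem unsqueezeAt_squeezeAt (a : K) {w : ℝ × ℝ} (hw : 0 < squeeze w) :
    unsqueezeAt κ a (squeezeAt κ a w) = w := by
  have := squeeze_mul w
  refine Prod.ext ?_ ?_
  · simp only [unsqueezeAt, squeezeAt, add_sub_cancel_left]
    rw [← this]
    field_simp
    ring
  · simp [squeezeAt, unsqueezeAt]

open Classical in
/-- The parametrisation around the ray attached at `a`. -/
noncomputable def rayParam (a : K) (w : ℝ × ℝ) : BlackHole K :=
  if h : w.2 = 0 ∧ w.1 < 0 then Sum.inr (a, ⟨w.1, h.2⟩) else Sum.inl (kroneckerMap (squeezeAt κ a w))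

/-- The map which collapses the closed rays. -/
noncomputable def collapse : BlackHole K → UnitAddCircle × UnitAddCircle :=
  Sum.elim id fun x => kroneckerMap (0, κ x.1)

theorem rayParam_of_pos (a : K) {w : ℝ × ℝ} (hw : 0 < squeeze w) :
    rayParam κ a w = Sum.inl (kroneckerMap (squeezeAt κ a w)) := by
  rw [rayParam, dif_neg]
  rintro ⟨h2, h1⟩
  have : w = (w.1, 0) := Prod.ext rfl h2
  rw [this, squeeze_zero_right, max_eq_right h1.le] at hw
  exact hw.false

theorem rayParam_of_neg (a : K) {y : ℝ} (hy : y < 0) :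
    rayParam κ a (y, 0) = Sum.inr (a, ⟨y, hy⟩) := by
  rw [rayParam, dif_pos ⟨rfl, hy⟩]

theorem rayParam_of_nonneg (a : K) {y : ℝ} (hy : 0 ≤ y) :
    rayParam κ a (y, 0) = Sum.inl (kroneckerMap (y, κ a)) := by
  rw [rayParam, dif_neg (by simpa using hy), squeezeAt, squeeze_zero_right, max_eq_left hy,
    add_zero]

theorem collapse_rayParam (a : K) (w : ℝ × ℝ) :
    collapse κ (rayParam κ a w) = kroneckerMap (squeezeAt κ a w) := by
  by_cases h : w.2 = 0 ∧ w.1 < 0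
  · obtain ⟨y, u⟩ := w
    obtain ⟨rfl, hy : y < 0⟩ := h
    rw [rayParam_of_neg κ a hy]
    simp [collapse, squeezeAt, squeeze_zero_right, max_eq_right hy.le]
  · rw [rayParam, dif_neg h]
    rfl

/-- The elements of `K` are pairwise independent modulo `ℤ + √2 ℤ`. -/
def IndependentSqrtTwo : Prop :=
  ∀ a b (m n : ℤ), κ a - κ b = m + n * √2 → a = b


variable {κ}

theorem IndependentSqrtTwo.eq_of_kroneckerMap_eq (hκ : IndependentSqrtTwo κ) {a b : K} {s t : ℝ}
    (h : kroneckerMap (s, κ a) = kroneckerMap (t, κ b)) : a = b ∧ s = t := by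
  obtain ⟨m, n, -, hm⟩ := exists_int_of_kroneckerMap_eq h
  obtain rfl : a = b := hκ a b m (-n) (by rw [hm]; push_cast; ring)
  exact ⟨rfl, congrArg Prod.fst (eq_of_kroneckerMap_eq_of_snd_eq h rfl)⟩

/-- The point `w` lies on the closed ray and collapses to time `0`; so `v` collapses to integer
time, and `squeeze v < 1` makes it `0`. Both points are then on closed rays, which are disjoint by
independence. -/
theorem IndependentSqrtTwo.eq_of_rayParam_eq_of_squeeze_eq_zero (hκ : IndependentSqrtTwo κ)
    {a b : K} {w v : ℝ × ℝ} (hv : squeeze v < 1) (hw : squeeze w = 0)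
    (h : rayParam κ a w = rayParam κ b v) : a = b ∧ w = v := by
  obtain ⟨y, u⟩ := w
  obtain ⟨y', u'⟩ := v
  have h1 := congrArg (collapse κ) h
  rw [collapse_rayParam, collapse_rayParam] at h1
  obtain ⟨m, n, hn, hm⟩ := exists_int_of_kroneckerMap_eq h1
  simp only [squeezeAt] at hn hm
  have hv0 := squeeze_nonneg (y', u')
  have hn0 : n = 0 := by
    refine Int.abs_lt_one_iff.1 ?_
    have : |(n : ℝ)| < 1 := by rw [← hn, hw, abs_lt]; constructor <;> linarith
    exact_mod_cast this
  rw [hn0, hw, Int.cast_zero] at hn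
  obtain ⟨rfl, hy⟩ : u = 0 ∧ y ≤ 0 := squeeze_eq_zero hw
  have hv1 : squeeze (y', u') = 0 := by linarith
  obtain ⟨rfl, hy'⟩ : u' = 0 ∧ y' ≤ 0 := squeeze_eq_zero hv1
  obtain rfl : a = b := hκ a b m 0 (by
    rw [hn0] at hm
    push_cast at hm ⊢
    linarith)
  refine ⟨rfl, ?_⟩
  rcases hy.lt_or_eq with hy | rfl <;> rcases hy'.lt_or_eq with hy' | rfl
  · rw [rayParam_of_neg κ a hy, rayParam_of_neg κ a hy'] at h
    have : y = y' := congrArg Subtype.val (Prod.ext_iff.1 (Sum.inr_injective h)).2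
    rw [this]
  · rw [rayParam_of_neg κ a hy, rayParam_of_nonneg κ a le_rfl] at h
    exact absurd h (by simp)
  · rw [rayParam_of_neg κ a hy', rayParam_of_nonneg κ a le_rfl] at h
    exact absurd h (by simp)
  · rfl

/-- Off the closed ray squeezing is invertible, and the bounds keep the squeezed points within less
than one period of each other in both coordinates. -/
theorem IndependentSqrtTwo.rayParam_inj (hκ : IndependentSqrtTwo κ) {a : K} {w v : ℝ × ℝ}
    (hw : squeeze w < 1) (hv : squeeze v < 1) (huv : |w.2 - v.2| < 1)
    (h : rayParam κ a w = rayParam κ a v) : w = v := by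
  rcases (squeeze_nonneg w).eq_or_lt with hw0 | hw0
  · exact (hκ.eq_of_rayParam_eq_of_squeeze_eq_zero hv hw0.symm h).2
  rcases (squeeze_nonneg v).eq_or_lt with hv0 | hv0
  · exact (hκ.eq_of_rayParam_eq_of_squeeze_eq_zero hw hv0.symm h.symm).2.symm
  have h1 := congrArg (collapse κ) h
  rw [collapse_rayParam, collapse_rayParam] at h1
  have h2 : squeezeAt κ a w = squeezeAt κ a v := by
    refine _root_.eq_of_kroneckerMap_eq h1 ?_ ?_
    · simp only [squeezeAt]
      rw [abs_lt]
      constructor <;> linarith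
    · simpa [squeezeAt] using huv
  rw [← unsqueezeAt_squeezeAt κ a hw0, h2, unsqueezeAt_squeezeAt κ a hv0]

/-- The parametrisations of the surface: the complement in the torus of the points where rays
are attached is covered by the plane, and there is a parametrisation around every ray. -/
noncomputable def blackHoleParam (κ : K → ℝ) : Option K → ℝ × ℝ → BlackHole K
  | none => fun w => Sum.inl (kroneckerMap w)
  | some a => rayParam κ a

/-- The domains of the parametrisations of the surface. -/
def blackHoleDom (κ : K → ℝ) : Option K → Set (ℝ × ℝ)
  | none => {w | ∀ a, kroneckerMap w ≠ kroneckerMap (0, κ a)}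
  | some _ => {w | squeeze w < 1}

theorem isOpen_blackHoleDom [TopologicalSpace K] [CompactSpace K] (hc : Continuous κ)
    (i : Option K) : IsOpen (blackHoleDom κ i) := by
  cases i with
  | none =>
    -- Compactness of `K` makes the set of attached points closed.
    have h : IsCompact (range fun a => kroneckerMap (0, κ a)) :=
      isCompact_range (continuous_kroneckerMap.comp (continuous_const.prodMk hc))
    convert! h.isClosed.isOpen_compl.preimage continuous_kroneckerMap using 1
    ext w
    simp [blackHoleDom, eq_comm]
  | some a => exact isOpen_lt continuous_squeeze continuous_const

theorem IndependentSqrtTwo.transition (hκ : IndependentSqrtTwo κ) (i j : Option K) (w v : ℝ × ℝ)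
    (hw : w ∈ blackHoleDom κ i) (hv : v ∈ blackHoleDom κ j)
    (h : blackHoleParam κ i w = blackHoleParam κ j v) :
    ∃ τ : ℝ × ℝ → ℝ × ℝ, ContinuousAt τ w ∧ τ w = v ∧ ∀ᶠ w' in 𝓝 w,
      blackHoleParam κ j (τ w') = blackHoleParam κ i w' ∧ (τ w').2 = w'.2 + (v.2 - w.2) := by
  have pos_of_none : ∀ (a : K) (w v : ℝ × ℝ), v ∈ blackHoleDom κ none →
      rayParam κ a w = Sum.inl (kroneckerMap v) → 0 < squeeze w := by
    intro a w v hv h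
    refine lt_of_le_of_ne (squeeze_nonneg w) fun h0 => hv a ?_
    have h1 := congrArg (collapse κ) h
    rw [collapse_rayParam] at h1
    obtain ⟨h2, -⟩ := squeeze_eq_zero h0.symm
    simpa [squeezeAt, ← h0, h2, collapse] using h1.symm
  have eventually_pos : ∀ w : ℝ × ℝ, 0 < squeeze w → ∀ᶠ w' in 𝓝 w, 0 < squeeze w' := fun w hw =>
    continuous_squeeze.continuousAt.eventually_const_lt hw
  cases i with
  | none =>
    cases j with
    | none =>
      have h' : kroneckerMap w = kroneckerMap v := Sum.inl_injective h
      refine ⟨fun w' => w' + (v - w), by fun_prop, by simp, Eventually.of_forall fun w' => ⟨?_, rfl⟩⟩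
      simp only [blackHoleParam, kroneckerMap_add_sub h']
    | some b =>
      have hv0 := pos_of_none b v w hw h.symm
      have h' : kroneckerMap w = kroneckerMap (squeezeAt κ b v) := by
        have := congrArg (collapse κ) h
        rwa [blackHoleParam, blackHoleParam, collapse_rayParam] at this
      have hpos : ∀ᶠ w' in 𝓝 w, 0 < (w' + (squeezeAt κ b v - w)).1 :=
        Continuous.continuousAt (by fun_prop) |>.eventually_const_lt
          (by simpa [squeezeAt] using hv0)
      refine ⟨fun w' => unsqueezeAt κ b (w' + (squeezeAt κ b v - w)), ?_, ?_, ?_⟩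
      · exact ContinuousAt.comp (f := fun w' => w' + (squeezeAt κ b v - w))
          (continuousAt_unsqueezeAt κ b hpos.self_of_nhds) (by fun_prop)
      · simp [unsqueezeAt_squeezeAt κ b hv0]
      · filter_upwards [hpos] with w' hw'
        have h3 := squeezeAt_unsqueezeAt κ b hw'
        refine ⟨?_, ?_⟩
        · have h4 : squeeze (unsqueezeAt κ b (w' + (squeezeAt κ b v - w))) =
              (w' + (squeezeAt κ b v - w)).1 := congrArg Prod.fst h3
          simp only [blackHoleParam]
          rw [rayParam_of_pos κ b (by rw [h4]; exact hw'), h3, kroneckerMap_add_sub h']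
        · simp [unsqueezeAt, squeezeAt]
          ring
  | some a =>
    cases j with
    | none =>
      have hw0 := pos_of_none a w v hv h
      have h' : kroneckerMap (squeezeAt κ a w) = kroneckerMap v := by
        have := congrArg (collapse κ) h
        rwa [blackHoleParam, blackHoleParam, collapse_rayParam] at this
      have hcont := continuous_squeezeAt κ a
      refine ⟨fun w' => squeezeAt κ a w' + (v - squeezeAt κ a w), by fun_prop, by simp, ?_⟩
      filter_upwards [eventually_pos w hw0] with w' hw'
      refine ⟨?_, ?_⟩
      · simp only [blackHoleParam]
        rw [rayParam_of_pos κ a hw', kroneckerMap_add_sub h']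
      · simp [squeezeAt]
        ring
    | some b =>
      -- A point of a closed ray has only one preimage under the ray parametrisations on their
      -- domains, so there the identity serves. Otherwise both points have positive `squeeze`, and
      -- the transition is squeeze, translate by a period, unsqueeze.
      by_cases hwv : a = b ∧ w = v
      · obtain ⟨rfl, rfl⟩ := hwv
        exact ⟨id, continuousAt_id, rfl, Eventually.of_forall fun w' => by simp⟩
      have hw0 : 0 < squeeze w := lt_of_le_of_ne (squeeze_nonneg w) fun h0 =>
        hwv (hκ.eq_of_rayParam_eq_of_squeeze_eq_zero hv h0.symm h)
      have hv0 : 0 < squeeze v := lt_of_le_of_ne (squeeze_nonneg v) fun h0 =>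
        hwv ((hκ.eq_of_rayParam_eq_of_squeeze_eq_zero hw h0.symm h.symm).imp Eq.symm Eq.symm)
      have h' : kroneckerMap (squeezeAt κ a w) = kroneckerMap (squeezeAt κ b v) := by
        have := congrArg (collapse κ) h
        rwa [blackHoleParam, blackHoleParam, collapse_rayParam, collapse_rayParam] at this
      have hcont := continuous_squeezeAt κ a
      set σ : ℝ × ℝ → ℝ × ℝ := fun w' =>
        squeezeAt κ a w' + (squeezeAt κ b v - squeezeAt κ a w) with hσ
      have hσc : Continuous σ := by fun_prop
      have hpos : ∀ᶠ w' in 𝓝 w, 0 < (σ w').1 :=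
        Continuous.continuousAt (by fun_prop) |>.eventually_const_lt
          (by simpa [squeezeAt, σ] using hv0)
      refine ⟨fun w' => unsqueezeAt κ b (σ w'), ?_, ?_, ?_⟩
      · exact ContinuousAt.comp (f := σ)
          (continuousAt_unsqueezeAt κ b hpos.self_of_nhds) (by fun_prop)
      · simp [σ, unsqueezeAt_squeezeAt κ b hv0]
      · filter_upwards [hpos, eventually_pos w hw0] with w' hw' hw1
        have h3 := squeezeAt_unsqueezeAt κ b hw'
        refine ⟨?_, ?_⟩
        · have h4 : squeeze (unsqueezeAt κ b (σ w')) = (σ w').1 := congrArg Prod.fst h3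
          simp only [blackHoleParam]
          rw [rayParam_of_pos κ b (by rw [h4]; exact hw'), h3, kroneckerMap_add_sub h',
            rayParam_of_pos κ a hw1]
        · simp [unsqueezeAt, squeezeAt, σ]
          ring

/-- The surface obtained from the torus by attaching rays. -/
noncomputable def blackHoleGluing [TopologicalSpace K] [CompactSpace K] (hc : Continuous κ)
    (hκ : IndependentSqrtTwo κ) : FoliatedGluing (Option K) (BlackHole K) where
  f := blackHoleParam κ
  dom := blackHoleDom κ
  isOpen_dom := isOpen_blackHoleDom hc
  cover := by
    rintro (q | ⟨a, y, hy⟩)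
    · obtain ⟨w, rfl⟩ := kroneckerMap_surjective q
      by_cases hw : w ∈ blackHoleDom κ none
      · exact ⟨none, w, hw, rfl⟩
      · obtain ⟨a, ha⟩ : ∃ a, kroneckerMap w = kroneckerMap (0, κ a) := by
          simpa [blackHoleDom] using hw
        refine ⟨some a, (0, 0), ?_, ?_⟩
        · simp [blackHoleDom, squeeze_zero_right]
        · rw [ha]
          exact rayParam_of_nonneg κ a le_rfl
    · refine ⟨some a, (y, 0), ?_, rayParam_of_neg κ a hy⟩
      have : y < 1 := lt_trans hy one_pos
      simp [blackHoleDom, squeeze_zero_right, this]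
  locally_injOn := by
    intro i w hw
    refine ⟨Metric.ball w (1 / 2) ∩ blackHoleDom κ i, inter_subset_right,
      Metric.isOpen_ball.inter (isOpen_blackHoleDom hc i), ⟨by simp, hw⟩, ?_⟩
    rintro v ⟨hv, hvd⟩ v' ⟨hv', hvd'⟩ h
    have hd : dist v v' < 1 := by
      have := dist_triangle_right v v' w
      rw [Metric.mem_ball] at hv hv'
      linarith
    rw [Prod.dist_eq, max_lt_iff, Real.dist_eq, Real.dist_eq] at hd
    cases i with
    | none => exact eq_of_kroneckerMap_eq (Sum.inl_injective h) hd.1 hd.2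
    | some a => exact hκ.rayParam_inj hvd hvd' hd.2 h
  transition := hκ.transition

end BlackHole

/-! ### The leaves -/

section Leaves

variable {K : Type} {κ : K → ℝ}

theorem exists_of_rayParam_eq_inl {a : K} {s : ℝ} {q : UnitAddCircle × UnitAddCircle}
    (h : rayParam κ a (s, 0) = Sum.inl q) : 0 ≤ s ∧ q = kroneckerMap (s, κ a) := by
  rcases lt_or_ge s 0 with hs | hs
  · rw [rayParam_of_neg κ a hs] at h
    exact absurd h (by simp)
  · rw [rayParam_of_nonneg κ a hs] at h
    exact ⟨hs, (Sum.inl_injective h).symm⟩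

/-- The leaves: the lines of the torus which miss the points where rays are attached, the half
lines prolonged by the rays, and the opposite open half lines. -/
noncomputable def blackHoleLine (κ : K → ℝ) :
    {q : UnitAddCircle × UnitAddCircle // ∀ a s, q + kroneckerMap (s, 0) ≠ kroneckerMap (0, κ a)} ⊕
      K ⊕ K → ℝ → BlackHole K
  | Sum.inl q => fun s => Sum.inl (q.1 + kroneckerMap (s, 0))
  | Sum.inr (Sum.inl a) => fun s => rayParam κ a (s, 0)
  | Sum.inr (Sum.inr a) => fun s => Sum.inl (kroneckerMap (-Real.exp s, κ a))

theorem exists_mem_range_blackHoleLine (x : BlackHole K) :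
    ∃ l, x ∈ range (blackHoleLine κ l) := by
  obtain q | ⟨a, y, hy⟩ := x
  · by_cases hq : ∀ a s, q + kroneckerMap (s, 0) ≠ kroneckerMap (0, κ a)
    · refine ⟨Sum.inl ⟨q, hq⟩, 0, ?_⟩
      simp [blackHoleLine, kroneckerMap]
    · push Not at hq
      obtain ⟨a, s, hs⟩ := hq
      have hqs : q = kroneckerMap (-s, κ a) := by
        rw [← eq_sub_iff_add_eq, ← kroneckerMap_sub] at hs
        simpa using hs
      rcases le_or_gt 0 (-s) with h | h
      · exact ⟨Sum.inr (Sum.inl a), -s, by rw [hqs]; exact rayParam_of_nonneg κ a h⟩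
      · refine ⟨Sum.inr (Sum.inr a), Real.log s, ?_⟩
        simp only [blackHoleLine]
        rw [Real.exp_log (by linarith), hqs]
  · exact ⟨Sum.inr (Sum.inl a), y, rayParam_of_neg κ a hy⟩

theorem IndependentSqrtTwo.blackHoleLine_injective (hκ : IndependentSqrtTwo κ) (l) :
    Function.Injective (blackHoleLine κ l) := by
  intro s s' h
  obtain q | a | a := l
  · have := add_left_cancel (Sum.inl_injective h)
    exact congrArg Prod.fst (eq_of_kroneckerMap_eq_of_snd_eq this rfl)
  · replace h : rayParam κ a (s, 0) = rayParam κ a (s', 0) := h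
    rcases lt_or_ge s' 0 with hs | hs
    · refine congrArg Prod.fst (hκ.eq_of_rayParam_eq_of_squeeze_eq_zero
        (w := (s', 0)) (v := (s, 0)) ?_ ?_ h.symm).2.symm
      · rcases lt_or_ge s 0 with hs' | hs'
        · simp [squeeze_zero_right, hs'.trans one_pos]
        · rw [rayParam_of_neg κ a hs, rayParam_of_nonneg κ a hs'] at h
          exact absurd h (by simp)
      · simp [squeeze_zero_right, hs.le]
    · rw [rayParam_of_nonneg κ a hs] at h
      exact ((hκ.eq_of_kroneckerMap_eq (exists_of_rayParam_eq_inl h).2).2).symm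
  · have := (hκ.eq_of_kroneckerMap_eq (Sum.inl_injective h)).2
    exact Real.exp_injective (neg_injective this)

/-- Curves of different kinds never meet: whole lines avoid the attached points, and the two halves
at `a` have times of opposite sign. Within one kind, independence (or translation in time, for whole
lines) gives the same range. -/
theorem IndependentSqrtTwo.range_blackHoleLine_subset (hκ : IndependentSqrtTwo κ) (l l')
    (s s' : ℝ) (h : blackHoleLine κ l s = blackHoleLine κ l' s') :
    range (blackHoleLine κ l) ⊆ range (blackHoleLine κ l') := by
  have aux : ∀ (q : UnitAddCircle × UnitAddCircle) (a : K) (s s' : ℝ),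
      q + kroneckerMap (s, 0) = kroneckerMap (s', κ a) →
      q + kroneckerMap (s - s', 0) = kroneckerMap (0, κ a) := by
    intro q a s s' h
    have h1 : ((s - s', 0) : ℝ × ℝ) = (s, 0) - (s', 0) := by simp
    have h2 : ((0, κ a) : ℝ × ℝ) = (s', κ a) - (s', 0) := by simp
    rw [h1, h2, kroneckerMap_sub, kroneckerMap_sub, ← h]
    abel
  obtain q | a | a := l <;> obtain q' | a' | a' := l'
  · rintro _ ⟨r, rfl⟩
    refine ⟨r + (s' - s), ?_⟩
    have h := Sum.inl_injective h
    have h1 : ((r + (s' - s), 0) : ℝ × ℝ) = (r, 0) + ((s', 0) - (s, 0)) := by simp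
    simp only [blackHoleLine]
    rw [h1, kroneckerMap_add, kroneckerMap_sub, eq_sub_of_add_eq h]
    congr 1
    abel
  · exact absurd (aux _ _ _ _ (exists_of_rayParam_eq_inl h.symm).2) (q.2 _ _)
  · exact absurd (aux _ _ _ _ (Sum.inl_injective h)) (q.2 _ _)
  · exact absurd (aux _ _ _ _ (exists_of_rayParam_eq_inl h).2) (q'.2 _ _)
  · replace h : rayParam κ a (s, 0) = rayParam κ a' (s', 0) := h
    suffices a = a' by rw [this]
    rcases lt_or_ge s' 0 with hs | hs
    · rcases lt_or_ge s 0 with hs' | hs'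
      · rw [rayParam_of_neg κ a hs', rayParam_of_neg κ a' hs] at h
        exact (Prod.ext_iff.1 (Sum.inr_injective h)).1
      · rw [rayParam_of_nonneg κ a hs', rayParam_of_neg κ a' hs] at h
        exact absurd h (by simp)
    · rw [rayParam_of_nonneg κ a' hs] at h
      exact ((hκ.eq_of_kroneckerMap_eq (exists_of_rayParam_eq_inl h).2).1).symm
  · obtain ⟨hs, h⟩ := exists_of_rayParam_eq_inl h
    have := (hκ.eq_of_kroneckerMap_eq h).2
    have := Real.exp_pos s'
    linarith
  · exact absurd (aux _ _ _ _ (Sum.inl_injective h).symm) (q'.2 _ _)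
  · obtain ⟨hs, h⟩ := exists_of_rayParam_eq_inl h.symm
    have := (hκ.eq_of_kroneckerMap_eq h).2
    have := Real.exp_pos s
    linarith
  · rw [(hκ.eq_of_kroneckerMap_eq (Sum.inl_injective h)).1]

/-- One Kronecker half leaf in each leaf is all that density needs; `ε` is its direction. -/
theorem exists_end_of_blackHoleLine (l) :
    ∃ (ε : ℤ) (q : UnitAddCircle × UnitAddCircle), ε ≠ 0 ∧
      ∀ s > 0, Sum.inl (q + kroneckerMap (ε * s, 0)) ∈ range (blackHoleLine κ l) := by
  obtain q | a | a := l
  · exact ⟨1, q.1, one_ne_zero, fun s _ => ⟨s, by simp [blackHoleLine]⟩⟩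
  · refine ⟨1, kroneckerMap (0, κ a), one_ne_zero, fun s hs => ⟨s, ?_⟩⟩
    rw [← kroneckerMap_add]
    simpa [blackHoleLine] using rayParam_of_nonneg κ a (le_of_lt hs)
  · refine ⟨-1, kroneckerMap (0, κ a), by simp, fun s hs => ⟨Real.log s, ?_⟩⟩
    rw [← kroneckerMap_add]
    simp [blackHoleLine, Real.exp_log hs]

theorem IndependentSqrtTwo.eq_of_collapse_eq (hκ : IndependentSqrtTwo κ) {x y : BlackHole K}
    (h : collapse κ x = collapse κ y) : x = y ∨ ∃ (a : K) (s t : ℝ), s ≤ 0 ∧ t ≤ 0 ∧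
      x = rayParam κ a (s, 0) ∧ y = rayParam κ a (t, 0) := by
  obtain q | ⟨a, s, hs⟩ := x <;> obtain q' | ⟨b, t, ht⟩ := y
  · exact Or.inl (congrArg Sum.inl h)
  · refine Or.inr ⟨b, 0, t, le_rfl, le_of_lt ht, ?_, (rayParam_of_neg κ b ht).symm⟩
    rw [rayParam_of_nonneg κ b le_rfl]
    exact congrArg Sum.inl h
  · refine Or.inr ⟨a, s, 0, le_of_lt hs, le_rfl, (rayParam_of_neg κ a hs).symm, ?_⟩
    rw [rayParam_of_nonneg κ a le_rfl]
    exact congrArg Sum.inl h.symm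
  · obtain rfl := (hκ.eq_of_kroneckerMap_eq h).1
    exact Or.inr ⟨a, s, t, le_of_lt hs, le_of_lt ht, (rayParam_of_neg κ a hs).symm,
      (rayParam_of_neg κ a ht).symm⟩

variable [TopologicalSpace K] [CompactSpace K] (hc : Continuous κ) (hκ : IndependentSqrtTwo κ)

theorem isTangentLine_blackHoleLine (l) :
    @Foliation.IsTangentLine _ (blackHoleGluing hc hκ).topology (blackHoleGluing hc hκ).foliation
      (blackHoleLine κ l) := by
  refine (blackHoleGluing hc hκ).isTangentLine fun s => ?_
  obtain q | a | a := l
  · obtain ⟨w, hw⟩ := kroneckerMap_surjective q.1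
    have key : ∀ r, q.1 + kroneckerMap (r, 0) = kroneckerMap (w.1 + r, w.2) := by
      intro r
      rw [← hw, ← kroneckerMap_add]
      congr 1
      exact Prod.ext rfl (add_zero _)
    refine ⟨none, w.2, _, (Homeomorph.addLeft w.1).isOpenEmbedding,
      Eventually.of_forall fun r => ⟨fun a => ?_, ?_⟩⟩
    · exact key r ▸ q.2 a r
    · exact congrArg Sum.inl (key r)
  -- The ray parametrisation reaches only times below `1`; for later times the torus parametrisation
  -- applies, as the leaf does not return to an attached point.
  · rcases lt_or_ge s 1 with hs | hs
    · refine ⟨some a, 0, id, IsOpenEmbedding.id, ?_⟩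
      filter_upwards [eventually_lt_nhds hs] with r hr
      refine ⟨?_, rfl⟩
      change squeeze (r, 0) < 1
      rw [squeeze_zero_right]
      exact max_lt hr one_pos
    · refine ⟨none, κ a, id, IsOpenEmbedding.id, ?_⟩
      filter_upwards [eventually_gt_nhds (one_pos.trans_le hs)] with r hr
      exact ⟨fun b hb => hr.ne' (hκ.eq_of_kroneckerMap_eq hb).2, rayParam_of_nonneg κ a hr.le⟩
  · refine ⟨none, κ a, fun r => -Real.exp r,
      (Homeomorph.neg ℝ).isOpenEmbedding.comp Real.isOpenEmbedding_exp,
      Eventually.of_forall fun r => ⟨fun b hb => ?_, rfl⟩⟩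
    exact (neg_ne_zero.2 (Real.exp_ne_zero r)) (hκ.eq_of_kroneckerMap_eq hb).2

/-! ### Density, separation and non-metrisability -/

/-- In a ray parametrisation the points with `w.2 ≠ 0` are dense. They have time strictly between
`0` and `1`, so they land in the torus away from the attached points. -/
theorem nonempty_inter_preimage_inl {V : Set (BlackHole K)}
    (hV : IsOpen[(blackHoleGluing hc hκ).topology] V) (hne : V.Nonempty) :
    (blackHoleDom κ none ∩ blackHoleParam κ none ⁻¹' V).Nonempty := by
  obtain ⟨x, hx⟩ := hne
  obtain ⟨i, w, hw, rfl⟩ := (blackHoleGluing hc hκ).cover x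
  cases i with
  | none => exact ⟨w, hw, hx⟩
  | some a =>
    obtain ⟨v, ⟨hv1, hvV⟩, hv0⟩ := ((dense_compl_singleton (0 : ℝ)).preimage
      (isOpenMap_snd (X := ℝ))).inter_open_nonempty _ (hV (some a)) ⟨w, hw, hx⟩
    have hpos : 0 < squeeze v :=
      lt_of_le_of_ne (squeeze_nonneg v) fun h => hv0 (squeeze_eq_zero h.symm).1
    refine ⟨squeezeAt κ a v, fun b hb => ?_, ?_⟩
    · obtain ⟨m, n, hn, -⟩ := exists_int_of_kroneckerMap_eq hb
      simp only [squeezeAt, sub_zero] at hn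
      replace hv1 : squeeze v < 1 := hv1
      rw [hn] at hpos hv1
      have h1 : 0 < n := by exact_mod_cast hpos
      have h2 : n < 1 := by exact_mod_cast hv1
      omega
    · replace hvV : rayParam κ a v ∈ V := hvV
      rwa [rayParam_of_pos κ a hpos] at hvV

theorem dense_range_blackHoleLine (l) :
    @Dense _ (blackHoleGluing hc hκ).topology (range (blackHoleLine κ l)) := by
  let _ := (blackHoleGluing hc hκ).topology
  refine dense_iff_inter_open.2 fun V hV hne => ?_
  obtain ⟨ε, q, hε, hq⟩ := exists_end_of_blackHoleLine (κ := κ) l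
  obtain ⟨s, hs, w, hw, hws⟩ := exists_add_kroneckerMap_mem hε
    (isOpenMap_kroneckerMap _ (hV none)) ((nonempty_inter_preimage_inl hc hκ hV hne).image _) q
  refine ⟨_, ?_, hq s hs⟩
  rw [← hws]
  exact hw.2

theorem continuous_collapse :
    @Continuous _ _ (blackHoleGluing hc hκ).topology _ (collapse κ) := by
  refine (blackHoleGluing hc hκ).continuous_of_comp fun i => ?_
  cases i with
  | none => exact continuous_kroneckerMap
  | some a =>
    have : (fun w => collapse κ (rayParam κ a w)) = fun w => kroneckerMap (squeezeAt κ a w) :=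
      funext (collapse_rayParam κ a)
    change Continuous fun w => collapse κ (rayParam κ a w)
    rw [this]
    exact continuous_kroneckerMap.comp (continuous_squeezeAt κ a)

/-- Points with different images under `collapse` are separated in the torus. Otherwise distinct
points lie on one closed ray and are separated inside its parametrisation. -/
theorem t2Space_blackHole : @T2Space _ (blackHoleGluing hc hκ).topology := by
  let _ := (blackHoleGluing hc hκ).topology
  refine ⟨fun x y hxy => ?_⟩
  by_cases h : collapse κ x = collapse κ y
  · obtain h | ⟨a, s, t, hs, ht, rfl, rfl⟩ := hκ.eq_of_collapse_eq h
    · exact absurd h hxy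
    have hst : s ≠ t := by
      rintro rfl
      exact hxy rfl
    obtain ⟨U, V, hU, hV, hsU, htV, hUV⟩ := t2_separation hst
    -- Radius `1 / 2` keeps second coordinates less than `1` apart, as `rayParam_inj` requires.
    let S : Set ℝ → Set (ℝ × ℝ) := fun U => blackHoleDom κ (some a) ∩ U ×ˢ Metric.ball 0 (1 / 2)
    have hS : ∀ U, IsOpen U → IsOpen (rayParam κ a '' S U) := fun U hU =>
      (blackHoleGluing hc hκ).isOpen_image (i := some a)
        ((isOpen_blackHoleDom hc (some a)).inter (hU.prod Metric.isOpen_ball)) inter_subset_left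
    have hmem : ∀ (U : Set ℝ) (r : ℝ), r ∈ U → r ≤ 0 → rayParam κ a (r, 0) ∈ rayParam κ a '' S U :=
      fun U r hr hr0 => mem_image_of_mem _
        ⟨by simp [blackHoleDom, squeeze_zero_right, hr0], hr, by simp⟩
    refine ⟨_, _, hS U hU, hS V hV, hmem U s hsU hs, hmem V t htV ht, ?_⟩
    rw [Set.disjoint_left]
    rintro _ ⟨w, ⟨hw, hwU, hw2⟩, rfl⟩ ⟨v, ⟨hv, hvV, hv2⟩, hvw⟩
    have hd : |v.2 - w.2| < 1 := by
      rw [mem_ball_zero_iff, Real.norm_eq_abs] at hw2 hv2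
      have := abs_sub v.2 w.2
      linarith
    obtain rfl := hκ.rayParam_inj hv hw hd hvw
    exact Set.disjoint_left.1 hUV hwU hvV
  · exact separated_by_continuous (continuous_collapse hc hκ) h

theorem not_metrizableSpace_blackHole [Uncountable K] :
    ¬ @TopologicalSpace.MetrizableSpace _ (blackHoleGluing hc hκ).topology := by
  let _ := (blackHoleGluing hc hκ).topology
  intro hmet
  obtain ⟨a⟩ := (inferInstance : Nonempty K)
  have hsep : TopologicalSpace.SeparableSpace (BlackHole K) :=
    DenseRange.separableSpace (dense_range_blackHoleLine hc hκ (Sum.inr (Sum.inl a)))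
      (isTangentLine_blackHoleLine hc hκ _).continuous
  let _ := TopologicalSpace.metrizableSpaceMetric (BlackHole K)
  have : SecondCountableTopology (BlackHole K) :=
    UniformSpace.secondCountable_of_separable (BlackHole K)
  obtain ⟨c, hcount, hcover⟩ := (isLindelof_univ (X := BlackHole K)).elim_countable_subcover
    (fun i => blackHoleParam κ i '' blackHoleDom κ i)
    (fun i => (blackHoleGluing hc hκ).isOpen_image (isOpen_blackHoleDom hc i) Subset.rfl)
    (fun x _ => by
      obtain ⟨i, w, hw, h⟩ := (blackHoleGluing hc hκ).cover x
      exact mem_iUnion.2 ⟨i, w, hw, h⟩)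
  -- The attached point of `b` is covered only by the parametrisation `some b`, so a countable
  -- subcover must contain every index.
  have hall : ∀ b : K, some b ∈ c := by
    intro b
    obtain ⟨i, hi, w, hw, hwb⟩ := mem_iUnion₂.1 (hcover (mem_univ (rayParam κ b (0, 0))))
    cases i with
    | none =>
      rw [rayParam_of_nonneg κ b le_rfl] at hwb
      exact absurd (Sum.inl_injective hwb) (hw b)
    | some d =>
      rwa [(hκ.eq_of_rayParam_eq_of_squeeze_eq_zero hw (by simp [squeeze_zero_right]) hwb.symm).1]
  have : Countable K := by
    have : Countable c := hcount
    exact Function.Injective.countable (f := fun b : K => (⟨some b, hall b⟩ : c))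
      fun b b' h => by simpa using h
  exact not_countable (α := K) this

theorem isSurface_blackHole [Nonempty K] :
    @IsSurface _ (blackHoleGluing hc hκ).topology := by
  let _ := (blackHoleGluing hc hκ).topology
  refine ⟨t2Space_blackHole hc hκ, ?_, (blackHoleGluing hc hκ).exists_euclidean_chart⟩
  obtain ⟨a⟩ := (inferInstance : Nonempty K)
  have hdense := dense_range_blackHoleLine hc hκ (Sum.inr (Sum.inl a))
  -- The surface is the closure of one leaf, a connected set.
  have hconn : IsConnected (range (blackHoleLine κ (Sum.inr (Sum.inl a)))) :=
    isConnected_range (isTangentLine_blackHoleLine hc hκ _).continuous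
  rw [connectedSpace_iff_univ, ← hdense.closure_eq]
  exact hconn.closure

end Leaves

/-- There is a minimal foliation on a non-metrisable surface such that all leaves are real
lines. -/
theorem mainTheorem7 :
    ∃ (M : Type) (_ : TopologicalSpace M),
      IsSurface M ∧ ¬ TopologicalSpace.MetrizableSpace M ∧
        ∃ F : Foliation M, F.IsMinimal ∧ ∀ x : M, F.LeafIsRealLine x := by
  obtain ⟨κ, hc, hκ : IndependentSqrtTwo κ⟩ := exists_cantor_independent_sqrt_two
  have : Uncountable (ℕ → Bool) := by
    rw [← Cardinal.aleph0_lt_mk_iff]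
    simpa using Cardinal.cantor Cardinal.aleph0
  let _ := (blackHoleGluing hc hκ).topology
  have hγ := isTangentLine_blackHoleLine hc hκ
  refine ⟨BlackHole (ℕ → Bool), _, isSurface_blackHole hc hκ, not_metrizableSpace_blackHole hc hκ,
    (blackHoleGluing hc hκ).foliation, fun x => ?_,
    Foliation.leafIsRealLine hγ hκ.blackHoleLine_injective exists_mem_range_blackHoleLine
      hκ.range_blackHoleLine_subset⟩
  obtain ⟨l, hl⟩ := exists_mem_range_blackHoleLine (κ := κ) x
  rw [Foliation.leaf_eq_range hγ hκ.blackHoleLine_injective exists_mem_range_blackHoleLine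
    hκ.range_blackHoleLine_subset hl]
  exact dense_range_blackHoleLine hc hκ l
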